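/- All graphs are finite, simple and undirected. The Laplacian spectrum of a graph $G$ is the multiset of eigenvalues of its Laplacian matrix $L(G)=D(G)-A(G)$, where $A(G)$ is the adjacency matrix and $D(G)$ the diagonal matrix of vertex degrees. Two graphs are called $L$-cospectral if they have the same Laplacian spectrum, and $G$ is called $L$-DS (determined by its Laplacian spectrum) if every graph that is $L$-cospectral with $G$ is isomorphic to $G$. The join (or product) $G\times H$ of two graphs is the disjoint union of $G$ and $H$ together with all edges joining a vertex of $G$ to a vertex of $H$; $K_m$ denotes the complete graph on $m$ vertices. Theorem. If a tree $T$ is $L$-DS, then $T\times K_m$ is $L$-DS for every positive integer $m$. -/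

import Mathlib

universe u

namespace SimpleGraph

/-- The Laplacian spectrum of a finite graph: the multiset of the (real) eigenvalues, with
multiplicities, of its Laplacian matrix `D - A`. -/
noncomputable def lapSpec {V : Type*} [Fintype V] (G : SimpleGraph V) : Multiset ℝ := by
  classical
  exact Finset.univ.val.map (G.isHermitian_lapMatrix ℝ).eigenvalues

/-- Two finite graphs are `L`-cospectral if they have the same Laplacian spectrum. -/
def LCospectral {V W : Type*} [Fintype V] [Fintype W] (G : SimpleGraph V) (H : SimpleGraph W) :
    Prop :=
  G.lapSpec = H.lapSpec

/-- A finite graph is determined by its Laplacian spectrum if every finite graph that is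
`L`-cospectral with it is isomorphic to it. -/
def IsLDS {V : Type u} [Fintype V] (G : SimpleGraph V) : Prop :=
  ∀ (W : Type u) [Fintype W] (H : SimpleGraph W), LCospectral H G → Nonempty (H ≃g G)

/-- The join (called product, `G × H`) of two graphs: their disjoint union together with
all the edges joining a vertex of `G` to a vertex of `H`. -/
def join {V W : Type*} (G : SimpleGraph V) (H : SimpleGraph W) : SimpleGraph (V ⊕ W) :=
  (G ⊕g H) ⊔ completeBipartiteGraph V W

end SimpleGraph

/-! Complementation preserves `L`-cospectrality and turns `T × K_m` into `Tᶜ` plus `m` isolated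
vertices. So if `H` is cospectral with `T × K_m`, it suffices to split `m` isolated vertices off
`Hᶜ`: the rest is cospectral with `Tᶜ`, its complement is cospectral with `T`, and `T` is `L`-DS.
Let `n = |T|` and let `Tᶜ` have `k` components. The multiplicity of the eigenvalue 0 gives `Hᶜ`
exactly `k + m` components on `n + m` vertices. If one of them has more than `n - k` vertices, the
others are too many not to be singletons (`exists_iso_sum_bot`). Otherwise all eigenvalues of `Hᶜ`,
hence of `Tᶜ`, are at most `n - k` (`lapSpec_le_of_card_supp_le`), so on vectors of sum zero the
form of `T` is at least `k` times the squared norm; for `k < n` this contradicts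
`IsTree.exists_dotProduct_lapMatrix_lt`. -/

namespace SimpleGraph

/-! ### Laplacian spectra: sums, complements, components and eigenvalue bounds. -/

section Spectrum

open scoped Classical MatrixOrder
open Matrix Polynomial

variable {V W : Type*} [Fintype V] [Fintype W]

/-- The characteristic polynomial of the Laplacian matrix. -/
noncomputable def lapCharpoly (G : SimpleGraph V) : ℝ[X] := (G.lapMatrix ℝ).charpoly

lemma lapCharpoly_eq (G : SimpleGraph V) [DecidableEq V] [DecidableRel G.Adj] :
    G.lapCharpoly = (G.lapMatrix ℝ).charpoly := by
  unfold lapCharpoly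
  congr!

lemma lapSpec_eq_map (G : SimpleGraph V) [DecidableEq V] [DecidableRel G.Adj] :
    G.lapSpec = Finset.univ.val.map (G.isHermitian_lapMatrix ℝ).eigenvalues := by
  unfold lapSpec
  congr!

lemma lapCharpoly_eq_prod (G : SimpleGraph V) :
    G.lapCharpoly = (G.lapSpec.map fun a => X - C a).prod := by
  rw [lapSpec_eq_map, lapCharpoly, (G.isHermitian_lapMatrix ℝ).charpoly_eq, Multiset.map_map]
  rfl

lemma lapSpec_eq_roots (G : SimpleGraph V) : G.lapSpec = G.lapCharpoly.roots := by
  rw [lapCharpoly_eq_prod, roots_multiset_prod_X_sub_C]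

lemma lCospectral_iff_lapCharpoly {G : SimpleGraph V} {H : SimpleGraph W} :
    LCospectral G H ↔ G.lapCharpoly = H.lapCharpoly := by
  refine ⟨fun h => ?_, fun h => ?_⟩
  · rw [lapCharpoly_eq_prod, lapCharpoly_eq_prod, h]
  · rw [LCospectral, lapSpec_eq_roots, lapSpec_eq_roots, h]

lemma card_lapSpec (G : SimpleGraph V) : Multiset.card G.lapSpec = Fintype.card V := by
  simp [lapSpec_eq_map]

lemma LCospectral.card_eq {G : SimpleGraph V} {H : SimpleGraph W} (h : LCospectral G H) :
    Fintype.card V = Fintype.card W := by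
  rw [← card_lapSpec G, ← card_lapSpec H, h]

lemma lapMatrix_reindex {G : SimpleGraph V} {H : SimpleGraph W} (e : G ≃g H) :
    Matrix.reindex e.toEquiv e.toEquiv (G.lapMatrix ℝ) = H.lapMatrix ℝ := by
  ext i j
  obtain ⟨i, rfl⟩ := e.surjective i
  obtain ⟨j, rfl⟩ := e.surjective j
  have h : H.degree (e i) = G.degree i := e.degree_eq i
  change G.lapMatrix ℝ (e.toEquiv.symm (e.toEquiv i)) (e.toEquiv.symm (e.toEquiv j)) = _
  rw [Equiv.symm_apply_apply, Equiv.symm_apply_apply]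
  have ha : H.Adj (e i) (e j) ↔ G.Adj i j := e.map_adj_iff
  simp [lapMatrix, degMatrix, diagonal_apply, adjMatrix_apply, h, ha]

lemma lapCharpoly_congr {G : SimpleGraph V} {H : SimpleGraph W} (e : G ≃g H) :
    G.lapCharpoly = H.lapCharpoly := by
  rw [lapCharpoly, lapCharpoly, ← lapMatrix_reindex e, charpoly_reindex]

lemma Iso.lCospectral {G : SimpleGraph V} {H : SimpleGraph W} (e : G ≃g H) : LCospectral G H :=
  lCospectral_iff_lapCharpoly.2 (lapCharpoly_congr e)

lemma lapMatrix_sum (G : SimpleGraph V) (H : SimpleGraph W) :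
    (G ⊕g H).lapMatrix ℝ = fromBlocks (G.lapMatrix ℝ) 0 0 (H.lapMatrix ℝ) := by
  ext i j
  rcases i with i | i <;> rcases j with j | j <;>
    simp [lapMatrix, degMatrix, diagonal_apply, adjMatrix_apply, degree_eq_sum_if_adj,
      -Finset.sum_boole]

lemma lapCharpoly_sum (G : SimpleGraph V) (H : SimpleGraph W) :
    (G ⊕g H).lapCharpoly = G.lapCharpoly * H.lapCharpoly := by
  rw [lapCharpoly_eq, lapMatrix_sum, charpoly_fromBlocks_zero₁₂]
  rfl

lemma lapMatrix_bot : (⊥ : SimpleGraph V).lapMatrix ℝ = 0 := by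
  ext i j
  simp [lapMatrix, degMatrix]

lemma lapCharpoly_bot : (⊥ : SimpleGraph V).lapCharpoly = X ^ Fintype.card V := by
  rw [lapCharpoly_eq, lapMatrix_bot, charpoly_zero]

lemma lapMatrix_compl (G : SimpleGraph V) :
    Gᶜ.lapMatrix ℝ = (Fintype.card V : ℝ) • (1 : Matrix V V ℝ) - Matrix.of (fun _ _ => 1)
      - G.lapMatrix ℝ := by
  ext i j
  have h := G.degree_compl i
  have h2 := G.degree_lt_card_verts i
  have h3 : (Gᶜ.degree i : ℝ) = Fintype.card V - 1 - G.degree i := by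
    rw [eq_sub_iff_add_eq, eq_sub_iff_add_eq]
    norm_cast
    lia
  by_cases hij : i = j
  · subst hij
    simp [lapMatrix, degMatrix, adjMatrix_apply, h3]
  · by_cases ha : G.Adj i j <;>
    simp [lapMatrix, degMatrix, adjMatrix_apply, hij, ha]

lemma lapMatrix_mul_of_one (G : SimpleGraph V) :
    G.lapMatrix ℝ * Matrix.of (fun _ _ => 1) = 0 := by
  ext i j
  exact congrFun G.lapMatrix_mulVec_const_eq_zero i

/-- With `J` the all-ones matrix, `L J = 0` factors `c + J + L` as `(c + L)(1 + c⁻¹ J)`, and the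
second factor is a rank-one update of the identity. -/
lemma eval_lapCharpoly_compl (G : SimpleGraph V) {c : ℝ} (hc : c ≠ 0) :
    (Gᶜ.lapCharpoly).eval (c + Fintype.card V) = (-1) ^ Fintype.card V *
      (G.lapCharpoly).eval (-c) * (1 + c⁻¹ * Fintype.card V) := by
  have hs (r : ℝ) : scalar V r = r • (1 : Matrix V V ℝ) := by
    rw [smul_one_eq_diagonal]
    rfl
  have hJ : replicateCol Unit (fun _ : V => c⁻¹) * replicateRow Unit (fun _ : V => (1 : ℝ))
      = c⁻¹ • Matrix.of (fun _ _ : V => (1 : ℝ)) := by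
    ext i j
    simp [mul_apply]
  have e : scalar V (c + Fintype.card V) - Gᶜ.lapMatrix ℝ
      = (-(scalar V (-c) - G.lapMatrix ℝ)) *
        (1 + replicateCol Unit (fun _ : V => c⁻¹) * replicateRow Unit (fun _ : V => (1 : ℝ))) := by
    rw [hJ, lapMatrix_compl, hs, hs, mul_add, mul_one, mul_smul_comm, neg_mul, sub_mul,
      lapMatrix_mul_of_one, smul_mul_assoc, one_mul, sub_zero]
    simp only [neg_smul, neg_neg, smul_smul, inv_mul_cancel₀ hc, one_smul]
    module
  rw [lapCharpoly_eq, eval_charpoly, e, det_mul, det_neg,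
    det_one_add_replicateCol_mul_replicateRow, lapCharpoly, eval_charpoly]
  congr 2
  simp [dotProduct, mul_comm]

lemma LCospectral.compl {G : SimpleGraph V} {H : SimpleGraph W} (h : LCospectral G H) :
    LCospectral Gᶜ Hᶜ := by
  have hcard := h.card_eq
  rw [lCospectral_iff_lapCharpoly] at h ⊢
  refine eq_of_infinite_eval_eq _ _ ?_
  refine Set.Infinite.mono (s := {(Fintype.card V : ℝ)}ᶜ) (fun x hx => ?_)
    (Set.finite_singleton _).infinite_compl
  have hx : x - Fintype.card V ≠ 0 := sub_ne_zero.2 hx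
  have hG := eval_lapCharpoly_compl G hx
  have hH := eval_lapCharpoly_compl H (hcard ▸ hx)
  rw [sub_add_cancel] at hG hH
  rw [Set.mem_ofPred_eq, hG, hH, h, hcard]

lemma LCospectral.of_sum_bot {ι : Type*} [Fintype ι] {G : SimpleGraph V} {H : SimpleGraph W}
    (h : LCospectral (G ⊕g (⊥ : SimpleGraph ι)) (H ⊕g (⊥ : SimpleGraph ι))) :
    LCospectral G H := by
  rw [lCospectral_iff_lapCharpoly, lapCharpoly_sum, lapCharpoly_sum, lapCharpoly_bot] at h
  exact lCospectral_iff_lapCharpoly.2 (mul_right_cancel₀ (pow_ne_zero _ X_ne_zero) h)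

lemma lapSpec_sum_bot {ι : Type*} [Fintype ι] (G : SimpleGraph V) :
    (G ⊕g (⊥ : SimpleGraph ι)).lapSpec = G.lapSpec + Multiset.replicate (Fintype.card ι) 0 := by
  have h : G.lapCharpoly ≠ 0 := (charpoly_monic _).ne_zero
  rw [lapSpec_eq_roots, lapCharpoly_sum, lapCharpoly_bot,
    roots_mul (mul_ne_zero h (pow_ne_zero _ X_ne_zero)), ← lapSpec_eq_roots, roots_X_pow,
    Multiset.nsmul_singleton]

lemma count_zero_lapSpec (G : SimpleGraph V) :
    G.lapSpec.count 0 = Nat.card G.ConnectedComponent := by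
  rw [Nat.card_eq_fintype_card, card_connectedComponent_eq_finrank_ker_toLin'_lapMatrix]
  have h1 := (G.lapMatrix ℝ).toLin'.finrank_range_add_finrank_ker
  have h2 := (G.isHermitian_lapMatrix ℝ).rank_eq_card_non_zero_eigs
  have h3 : (G.lapMatrix ℝ).rank = Module.finrank ℝ (G.lapMatrix ℝ).toLin'.range := rfl
  have h4 := Fintype.card_subtype_compl (fun i => (G.isHermitian_lapMatrix ℝ).eigenvalues i = 0)
  have h5 := Fintype.card_subtype_le (fun i => (G.isHermitian_lapMatrix ℝ).eigenvalues i = 0)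
  have h6 : G.lapSpec.count 0
      = Fintype.card {i // (G.isHermitian_lapMatrix ℝ).eigenvalues i = 0} := by
    rw [lapSpec_eq_map, Multiset.count_map, Fintype.card_subtype]
    simp only [eq_comm]
    rfl
  rw [Module.finrank_fintype_fun_eq_card] at h1
  simp only [ne_eq] at h2
  lia

lemma card_connectedComponent_sum_bot {ι : Type*} [Fintype ι] (G : SimpleGraph V) :
    Nat.card (G ⊕g (⊥ : SimpleGraph ι)).ConnectedComponent
      = Nat.card G.ConnectedComponent + Fintype.card ι := by
  rw [← count_zero_lapSpec, ← count_zero_lapSpec, lapSpec_sum_bot, Multiset.count_add,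
    Multiset.count_replicate_self]

lemma LCospectral.card_connectedComponent_eq {G : SimpleGraph V} {H : SimpleGraph W}
    (h : LCospectral G H) :
    Nat.card G.ConnectedComponent = Nat.card H.ConnectedComponent := by
  rw [← count_zero_lapSpec, ← count_zero_lapSpec, h]

lemma forall_lapSpec_le_iff (G : SimpleGraph V) [DecidableEq V] [DecidableRel G.Adj] (s : ℝ) :
    (∀ μ ∈ G.lapSpec, μ ≤ s) ↔ ∀ x : V → ℝ, x ⬝ᵥ (G.lapMatrix ℝ *ᵥ x) ≤ s * (x ⬝ᵥ x) := by
  have hG := G.isHermitian_lapMatrix ℝ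
  have h1 : (∀ μ ∈ G.lapSpec, μ ≤ s) ↔ ∀ μ ∈ spectrum ℝ (G.lapMatrix ℝ), μ ≤ s := by
    rw [lapSpec_eq_map, hG.spectrum_real_eq_range_eigenvalues]
    simp
  have hsa : IsSelfAdjoint (G.lapMatrix ℝ) := hG
  rw [h1, ← le_algebraMap_iff_spectrum_le hsa, Matrix.le_iff, posSemidef_iff_dotProduct_mulVec]
  have h2 : (algebraMap ℝ (Matrix V V ℝ) s - G.lapMatrix ℝ).IsHermitian :=
    (isHermitian_diagonal _).sub hG
  have h3 (x : V → ℝ) : algebraMap ℝ (Matrix V V ℝ) s *ᵥ x = s • x := by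
    rw [Algebra.algebraMap_eq_smul_one, smul_mulVec, one_mulVec]
  simp only [h2, true_and, star_trivial, sub_mulVec, h3, dotProduct_sub, dotProduct_smul,
    smul_eq_mul, sub_nonneg]

lemma dotProduct_lapMatrix_mulVec (G : SimpleGraph V) (x : V → ℝ) :
    x ⬝ᵥ (G.lapMatrix ℝ *ᵥ x)
      = (∑ i : V, ∑ j : V, if G.Adj i j then (x i - x j) ^ 2 else 0) / 2 := by
  rw [← lapMatrix_toLinearMap₂', toLinearMap₂'_apply']

lemma dotProduct_lapMatrix_compl_mulVec (G : SimpleGraph V) {x : V → ℝ} (hx : ∑ i, x i = 0) :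
    x ⬝ᵥ (Gᶜ.lapMatrix ℝ *ᵥ x)
      = Fintype.card V * (x ⬝ᵥ x) - x ⬝ᵥ (G.lapMatrix ℝ *ᵥ x) := by
  have h : (Matrix.of (fun _ _ : V => (1 : ℝ))) *ᵥ x = 0 := by
    ext i
    simp [mulVec, dotProduct, hx]
  rw [lapMatrix_compl, sub_mulVec, sub_mulVec, h, smul_mulVec, one_mulVec, sub_zero,
    dotProduct_sub, dotProduct_smul, smul_eq_mul]

/-- Every Laplacian eigenvalue is at most the order of the largest connected component. -/
lemma lapSpec_le_of_card_supp_le (G : SimpleGraph V) (s : ℕ)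
    (hs : ∀ c : G.ConnectedComponent,
      (Finset.univ.filter fun v => G.connectedComponentMk v = c).card ≤ s) :
    ∀ μ ∈ G.lapSpec, μ ≤ s := by
  rw [forall_lapSpec_le_iff]
  intro x
  rw [dotProduct_lapMatrix_mulVec, div_le_iff₀ two_pos]
  let p := G.connectedComponentMk
  -- Completing every component to a clique only increases the quadratic form.
  have h1 : ∀ i j, (if G.Adj i j then (x i - x j) ^ 2 else 0)
      ≤ (if p i = p j then x i ^ 2 else 0) + (if p j = p i then x j ^ 2 else 0)
        - 2 * (if p i = p j then x i * x j else 0) := by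
    intro i j
    by_cases ha : G.Adj i j
    · have hp : p i = p j := ConnectedComponent.connectedComponentMk_eq_of_adj ha
      simp only [ha, hp, if_true]
      linarith [sq_nonneg (x i - x j)]
    · simp only [ha, if_false]
      by_cases hp : p i = p j
      · simp only [hp, if_true]
        linarith [sq_nonneg (x i - x j)]
      · simp [hp, Ne.symm hp]
  have h2 : ∑ i, ∑ j, (if p i = p j then x i ^ 2 else 0) ≤ s * (x ⬝ᵥ x) := by
    rw [dotProduct, Finset.mul_sum]
    refine Finset.sum_le_sum fun i _ => ?_
    rw [← Finset.sum_filter, Finset.sum_const, nsmul_eq_mul, ← sq]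
    refine mul_le_mul_of_nonneg_right ?_ (sq_nonneg _)
    have := hs (p i)
    simp only [eq_comm (a := p i)]
    exact_mod_cast this
  -- The cross terms add up to the squares of the component sums.
  have h3 : 0 ≤ ∑ i, ∑ j, (if p i = p j then x i * x j else 0) := by
    have : ∑ i, ∑ j, (if p i = p j then x i * x j else 0)
        = ∑ c, (∑ i, if p i = c then x i else 0) ^ 2 := by
      simp_rw [sq, Finset.sum_mul_sum]
      rw [Finset.sum_comm]
      conv_rhs => rw [Finset.sum_comm]
      rw [Finset.sum_comm]
      refine Finset.sum_congr rfl fun i _ => ?_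
      rw [Finset.sum_comm]
      refine Finset.sum_congr rfl fun j _ => ?_
      rw [Finset.sum_eq_single (p i)]
      · by_cases h : p i = p j <;> simp [h, eq_comm]
      · intro c _ hc
        simp [hc.symm]
      · simp
    rw [this]
    positivity
  calc _ ≤ ∑ i, ∑ j, ((if p i = p j then x i ^ 2 else 0) + (if p j = p i then x j ^ 2 else 0)
        - 2 * (if p i = p j then x i * x j else 0)) :=
        Finset.sum_le_sum fun i _ => Finset.sum_le_sum fun j _ => h1 i j
    _ = 2 * ∑ i, ∑ j, (if p i = p j then x i ^ 2 else 0)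
        - 2 * ∑ i, ∑ j, (if p i = p j then x i * x j else 0) := by
        simp only [Finset.sum_sub_distrib, Finset.sum_add_distrib, ← Finset.mul_sum]
        rw [Finset.sum_comm (f := fun i j => if p j = p i then x j ^ 2 else 0)]
        ring
    _ ≤ _ := by linarith

end Spectrum

/-! ### The test vector of a tree, and splitting off isolated vertices. -/

section Structure

open scoped Classical

variable {V W : Type*} [Fintype V] [Fintype W]

/-- A tree `T` on `n` vertices whose complement has `k < n` connected components admits a vector
orthogonal to the constants at which the Rayleigh quotient of its Laplacian is less than `k`. -/
lemma IsTree.exists_dotProduct_lapMatrix_lt {T : SimpleGraph V} (hT : T.IsTree)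
    (hlt : Nat.card Tᶜ.ConnectedComponent < Fintype.card V) :
    ∃ x : V → ℝ, ∑ i, x i = 0 ∧
      x ⬝ᵥ (T.lapMatrix ℝ).mulVec x < Nat.card Tᶜ.ConnectedComponent * (x ⬝ᵥ x) := by
  have := hT.connected.nonempty
  have hk : 0 < Nat.card Tᶜ.ConnectedComponent := Nat.card_pos
  have : Nontrivial V := Fintype.one_lt_card_iff_nontrivial.1 (by lia)
  obtain ⟨v, hv⟩ := hT.exists_vert_degree_one_of_nontrivial
  obtain ⟨u, hvu, huniq⟩ := degree_eq_one_iff_existsUnique_adj.1 hv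
  have huv : v ≠ u := hvu.ne
  -- The value at the leaf `v` makes the sum zero. An edge avoiding `u` also avoids `v`, so `x` is
  -- constant along it and only edges at `u` contribute.
  set x : V → ℝ := fun w => if w = v then 2 - Fintype.card V else if w = u then 0 else 1 with hx
  have hxu : x u = 0 := by simp [hx, huv.symm]
  have hxw : ∀ w, w ≠ v → w ≠ u → x w = 1 := fun w h1 h2 => by simp [hx, h1, h2]
  have hq : x ⬝ᵥ (T.lapMatrix ℝ).mulVec x = ∑ w, if T.Adj u w then x w ^ 2 else 0 := by
    have h1 : ∀ i j, (if T.Adj i j then (x i - x j) ^ 2 else 0)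
        = (if i = u then (if T.Adj u j then x j ^ 2 else 0) else 0)
          + (if j = u then (if T.Adj u i then x i ^ 2 else 0) else 0) := by
      intro i j
      by_cases hi : i = u
      · subst hi
        by_cases hj : j = i
        · subst hj; simp
        · simp [hxu, hj]
      · by_cases hj : j = u
        · subst hj
          simp [hxu, hi, T.adj_comm]
        · simp only [hi, hj, if_false, add_zero]
          split_ifs with ha
          · have hiv : i ≠ v := fun h => hj (huniq j (h ▸ ha))
            have hjv : j ≠ v := fun h => hi (huniq i (h ▸ ha.symm))
            simp [hxw i hiv hi, hxw j hjv hj]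
          · rfl
    rw [dotProduct_lapMatrix_mulVec]
    simp only [h1, Finset.sum_add_distrib]
    rw [Finset.sum_comm]
    simp
  have hxx : x ⬝ᵥ x = ∑ w, x w ^ 2 := by simp [dotProduct, sq]
  have hle : ∀ w ∈ Finset.univ, (if T.Adj u w then x w ^ 2 else 0) ≤ x w ^ 2 := fun w _ => by
    split_ifs
    · rfl
    · positivity
  refine ⟨x, ?_, ?_⟩
  · have h1 : ∀ w, x w = 1 - (if w = v then (Fintype.card V : ℝ) - 1 else 0)
        - (if w = u then 1 else 0) := by
      intro w
      by_cases h1 : w = v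
      · subst h1; simp [hx, huv]; ring
      · by_cases h2 : w = u
        · subst h2; simp [hx, h1]
        · simp [hx, h1, h2]
    simp_rw [h1]
    simp
  · rw [hq, hxx]
    -- The form is at most `x ⬝ᵥ x`. For `k = 1` strictness comes from a non-neighbour of `u`; for
    -- `k ≥ 2` it is enough that `x ≠ 0`.
    by_cases hk1 : Nat.card Tᶜ.ConnectedComponent = 1
    · have : Subsingleton Tᶜ.ConnectedComponent :=
        Finite.card_le_one_iff_subsingleton.1 hk1.le
      have hreach : Tᶜ.Reachable u v :=
        ConnectedComponent.exact (Subsingleton.elim _ _)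
      obtain ⟨w, hw⟩ : ∃ w, Tᶜ.Adj u w := by
        obtain ⟨p⟩ := hreach
        cases p with
        | nil => exact absurd rfl huv
        | cons h _ => exact ⟨_, h⟩
      rw [compl_adj] at hw
      rw [hk1, Nat.cast_one, one_mul]
      refine Finset.sum_lt_sum hle ⟨w, Finset.mem_univ w, ?_⟩
      have hwv : w ≠ v := fun h => hw.2 (h ▸ hvu.symm)
      simp [hw.2, hxw w hwv hw.1.symm]
    · have hpos : 0 < ∑ w, x w ^ 2 := by
        refine Finset.sum_pos' (fun _ _ => sq_nonneg _) ⟨v, Finset.mem_univ v, ?_⟩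
        have h3 : (3 : ℝ) ≤ Fintype.card V := by
          have : 3 ≤ Fintype.card V := by lia
          exact_mod_cast this
        have : x v ≠ 0 := by
          simp only [hx, if_true]
          linarith
        positivity
      have h2 : (2 : ℝ) ≤ Nat.card Tᶜ.ConnectedComponent := by
        have : 2 ≤ Nat.card Tᶜ.ConnectedComponent := by lia
        exact_mod_cast this
      have := Finset.sum_le_sum hle
      nlinarith

/-- If a connected component is so large that all vertices outside it must be isolated, then
isolated vertices can be split off. -/
lemma exists_iso_sum_bot (G : SimpleGraph W) {m : ℕ} (c : G.ConnectedComponent)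
    (hm : m + 1 ≤ Nat.card G.ConnectedComponent)
    (hc : Fintype.card W + 1 ≤ Nat.card G.ConnectedComponent
      + (Finset.univ.filter fun w => G.connectedComponentMk w = c).card) :
    ∃ s : Set W, Nonempty (G ≃g (G.induce s ⊕g (⊥ : SimpleGraph (Fin m)))) := by
  set S := Finset.univ.filter fun w => ¬ G.connectedComponentMk w = c with hS
  have hadd := Finset.card_filter_add_card_filter_not (s := (Finset.univ : Finset W))
    (fun w => G.connectedComponentMk w = c)
  rw [Finset.card_univ, ← hS] at hadd
  have himg : S.image G.connectedComponentMk = Finset.univ.erase c := by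
    ext d
    induction d using ConnectedComponent.ind with | _ w =>
    simp only [Finset.mem_image, Finset.mem_erase, Finset.mem_univ, and_true, hS,
      Finset.mem_filter, true_and]
    exact ⟨fun ⟨a, ha, hd⟩ => hd ▸ ha, fun h => ⟨w, h, rfl⟩⟩
  have hcard : (S.image G.connectedComponentMk).card + 1
      = Nat.card G.ConnectedComponent := by
    rw [himg, Finset.card_erase_add_one (Finset.mem_univ c), Finset.card_univ, Nat.card_eq_fintype_card]
  have hle := Finset.card_image_le (s := S) (f := G.connectedComponentMk)
  -- `S` maps onto the components other than `c`, and `hc` leaves it no more vertices than these.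
  have hinj : Set.InjOn G.connectedComponentMk S := Finset.card_image_iff.1 (by lia)
  have hiso : ∀ w ∈ S, ∀ z, ¬ G.Adj w z := by
    intro w hw z hwz
    have he : G.connectedComponentMk w = G.connectedComponentMk z :=
      ConnectedComponent.connectedComponentMk_eq_of_adj hwz
    have hz : z ∈ S := by
      simp only [hS, Finset.mem_filter, Finset.mem_univ, true_and] at hw ⊢
      rwa [← he]
    exact hwz.ne (hinj hw hz he)
  obtain ⟨R, hRS, hR⟩ := Finset.exists_subset_card_eq (s := S) (n := m) (by lia)
  refine ⟨{w | w ∉ R}, ⟨?_⟩⟩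
  have e : {w // ¬ w ∉ R} ≃ Fin m :=
    (Equiv.subtypeEquivRight fun w => not_not).trans (R.equivFinOfCardEq hR)
  refine Iso.symm ⟨((Equiv.refl _).sumCongr e.symm).trans (Equiv.sumCompl fun w => w ∉ R), ?_⟩
  have h1 (a : Fin m) : (e.symm a : W) ∈ S := hRS (not_not.1 (e.symm a).2)
  rintro (a | a) (b | b)
  · simp
  · simpa using fun h => hiso _ (h1 b) _ h.symm
  · simpa using hiso _ (h1 a) _
  · simpa using hiso _ (h1 a) _

end Structure

/-! ### Joins with complete graphs as complements. -/

section Join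

lemma compl_join_top {V ι : Type*} (G : SimpleGraph V) :
    (G.join (completeGraph ι))ᶜ = Gᶜ ⊕g (⊥ : SimpleGraph ι) := by
  ext (a | a) (b | b) <;> simp +contextual [join]

lemma compl_sum_bot {V ι : Type*} (G : SimpleGraph V) :
    (G ⊕g (⊥ : SimpleGraph ι))ᶜ = Gᶜ.join (completeGraph ι) := by
  rw [← compl_compl (Gᶜ.join _), compl_join_top, compl_compl]

/-- Isomorphic graphs have isomorphic complements. -/
def Iso.complCongr {V W : Type*} {G : SimpleGraph V} {H : SimpleGraph W} (e : G ≃g H) :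
    Gᶜ ≃g Hᶜ where
  toEquiv := e.toEquiv
  map_rel_iff' := by simp [compl_adj, e.map_adj_iff]

end Join

end SimpleGraph

theorem theorem4 {V : Type u} [Fintype V] (T : SimpleGraph V) (hT : T.IsTree)
    (hLDS : T.IsLDS) (m : ℕ) (hm : 1 ≤ m) :
    (T.join (SimpleGraph.completeGraph (Fin m))).IsLDS := by
  classical
  open SimpleGraph in
  intro W _ H hH
  have := hT.connected.nonempty
  have hC : LCospectral Hᶜ (Tᶜ ⊕g (⊥ : SimpleGraph (Fin m))) := by
    rw [← compl_join_top]
    exact hH.compl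
  have hcard := hC.card_eq
  have hcomp := hC.card_connectedComponent_eq
  rw [card_connectedComponent_sum_bot, Fintype.card_fin] at hcomp
  rw [Fintype.card_sum, Fintype.card_fin] at hcard
  have hk : 0 < Nat.card Tᶜ.ConnectedComponent := Nat.card_pos
  have hkn : Nat.card Tᶜ.ConnectedComponent ≤ Fintype.card V :=
    Nat.card_eq_fintype_card (α := V) ▸ Nat.card_le_card_of_surjective _ Quot.mk_surjective
  obtain ⟨c, hc⟩ : ∃ c : Hᶜ.ConnectedComponent,
      Fintype.card V - Nat.card Tᶜ.ConnectedComponent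
        < (Finset.univ.filter fun w => Hᶜ.connectedComponentMk w = c).card := by
    by_contra! hsmall
    rcases hkn.lt_or_eq with hlt | heq
    · obtain ⟨x, hx0, hx⟩ := hT.exists_dotProduct_lapMatrix_lt hlt
      have hspec := lapSpec_le_of_card_supp_le _ _ hsmall
      rw [hC, lapSpec_sum_bot] at hspec
      have hform := (forall_lapSpec_le_iff Tᶜ _).1
        (fun μ hμ => hspec μ (Multiset.mem_add.2 (Or.inl hμ))) x
      rw [dotProduct_lapMatrix_compl_mulVec _ hx0, Nat.cast_sub hkn, sub_mul] at hform
      linarith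
    -- For `k = n` the assumed bound is 0, but components are nonempty.
    · have : Nonempty W := Fintype.card_pos_iff.1 (by lia)
      obtain ⟨w⟩ := this
      have h := hsmall (Hᶜ.connectedComponentMk w)
      rw [heq, Nat.sub_self, Nat.le_zero, Finset.card_eq_zero] at h
      have hw : w ∈ Finset.univ.filter fun v =>
          Hᶜ.connectedComponentMk v = Hᶜ.connectedComponentMk w :=
        Finset.mem_filter.2 ⟨Finset.mem_univ w, rfl⟩
      rw [h] at hw
      exact absurd hw (Finset.notMem_empty w)
  obtain ⟨s, ⟨e⟩⟩ := exists_iso_sum_bot Hᶜ (m := m) c (by lia) (by lia)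
  have hco : LCospectral (Hᶜ.induce s)ᶜ T := by
    have h : LCospectral (Hᶜ.induce s) Tᶜ := .of_sum_bot (e.lCospectral.symm.trans hC)
    simpa using h.compl
  obtain ⟨f⟩ := hLDS s _ hco
  have f' : Hᶜ.induce s ≃g Tᶜ := by simpa using f.complCongr
  have e1 := e.trans (f'.sumCongr (Iso.refl (G := (⊥ : SimpleGraph (Fin m)))))
  have e2 := Iso.complCongr e1
  rw [compl_compl, compl_sum_bot, compl_compl] at e2
  exact ⟨e2⟩
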